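/- A Hardy field is a subfield $H$ of the ring of germs at $+\infty$ of real-valued differentiable functions defined on intervals $(a,+\infty)$, $a\in\mathbb{R}$, such that $H$ is closed under differentiation. It is totally ordered by: $f\le g$ if and only if $f(t)\le g(t)$ for all sufficiently large $t$. A maximal Hardy field is one that is maximal under inclusion among all Hardy fields. For an ordered set $S$, let $\operatorname{cf}(S)$ and $\operatorname{ci}(S)$ denote its cofinality and its coinitiality (the cofinality of $S$ with the reversed ordering), and for $a\in S$ put $S^{<a}=\{s\in S: s<a\}$ and $S^{>a}=\{s\in S: s>a\}$. If $H$ is a maximal Hardy field, then $\operatorname{cf}(H)>\omega$, and $$\operatorname{ci}(H)\ =\ \operatorname{cf}(H^{<a})\ =\ \operatorname{ci}(H^{>a})\ >\ \omega\qquad\text{for all } a\in H.$$ -/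

import Mathlib

open Filter Topology Cardinal

/-- The ring of germs at `+∞` of real valued functions (any function on an interval `(a, +∞)`
has the same germ as a function defined on all of `ℝ`). The relation `f ≤ g` on it
means `f t ≤ g t` for all sufficiently large `t`. -/
abbrev GermsAtInfinity : Type := Germ (atTop : Filter ℝ) ℝ

/-- The germ `f` is the germ of a function that is differentiable on some interval `(a, +∞)`,
and `f'` is the germ of the derivative of that function. -/
def GermHasDeriv (f f' : GermsAtInfinity) : Prop :=
  ∃ g g' : ℝ → ℝ, f = (g : GermsAtInfinity) ∧ f' = (g' : GermsAtInfinity) ∧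
    ∀ᶠ t in atTop, HasDerivAt g (g' t) t

/-- A Hardy field: a subfield of the ring of germs at `+∞` of differentiable real valued
functions (that is, a subring that happens to be a field) which is closed under
differentiation. -/
structure IsHardyField (H : Subring GermsAtInfinity) : Prop where
  isField : IsField H
  exists_deriv : ∀ f ∈ H, ∃ f' ∈ H, GermHasDeriv f f'

/-- The coinitiality of an ordered set: the cofinality of the set with the reversed order. -/
noncomputable def coinitiality (S : Type*) [Preorder S] : Cardinal :=
  Order.cof Sᵒᵈ

/-!
A Hardy field `H` with a countable cofinal subset is not maximal. There are functions
`y 0, y 1, …` with `(y k)' = y k * y (k + 1)`, each eventually above every element of `H` and above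
every power of its successor. A nonzero polynomial in `y k` over a field lying below `y k` is
controlled by its leading term, hence is a unit in the ring of germs, so adjoining all the `y k`
yields a larger Hardy field.

To get large enough `y k`, prescribe `y k` on `(-∞, k]` and solve the equations to the right. On
`[k, k + 1]` the solution `y k` depends only on the prescribed values of `y (k + 1)`, so iterating
the integral equation stabilises after finitely many steps on each bounded interval. Letting the
prescribed `y m` reach a huge value at `m` makes every `y k` with `k ≤ m` at least as large there.

The remaining cofinalities agree with that of `H`, because `H` is an ordered field, by means of the
maps `x ↦ -x` and `x ↦ a ± x⁻¹`.
-/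

section OrderedRing

open Polynomial

variable {A : Type*} [CommRing A]

section Growth

variable [PartialOrder A] [IsOrderedRing A] {R : Type*} [CommRing R] [Algebra R A] {y : A}

theorem one_le_aeval_of_monic (hy : ∀ a : R, algebraMap R A a ≤ y) {p : R[X]} (hp : p.Monic) :
    1 ≤ aeval y p := by
  induction hn : p.natDegree generalizing p with
  | zero => simp [hp.natDegree_eq_zero.mp hn]
  | succ n ih =>
    have h_divX : 1 ≤ aeval y p.divX :=
      ih (by rw [Monic, leadingCoeff, natDegree_divX_eq_natDegree_tsub_one, coeff_divX,
        Nat.sub_add_cancel (by omega)]; exact hp) (by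
          rw [natDegree_divX_eq_natDegree_tsub_one, hn, Nat.add_sub_cancel])
    have hy_nonneg : 0 ≤ y := by simpa using hy 0
    have h_const : 1 - algebraMap R A (p.coeff 0) ≤ y := by simpa using hy (1 - p.coeff 0)
    calc (1 : A) ≤ y + algebraMap R A (p.coeff 0) := sub_le_iff_le_add.mp h_const
      _ ≤ aeval y p.divX * y + algebraMap R A (p.coeff 0) := by
        gcongr
        exact le_mul_of_one_le_left hy_nonneg h_divX
      _ = aeval y p := by
        conv_rhs => rw [← divX_mul_X_add p]
        simp

theorem aeval_le_pow (hy : ∀ a : R, algebraMap R A a ≤ y) (p : R[X]) :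
    aeval y p ≤ y ^ (p.natDegree + 1) := by
  have h_monic : (X ^ (p.natDegree + 1) - p).Monic :=
    monic_X_pow_sub (degree_le_natDegree.trans_lt (by exact_mod_cast p.natDegree.lt_succ_self))
  have h_one_le := one_le_aeval_of_monic hy h_monic
  rw [map_sub, map_pow, aeval_X] at h_one_le
  exact sub_nonneg.mp (zero_le_one.trans h_one_le)

end Growth

/-- The subring of fractions `a / b` with `a, b ∈ R` and `b` a unit of `A`. It stands in for the
fraction field of `R` when `A`, like a ring of germs, is not a field. -/
def fractionSubring (R : Subring A) : Subring A where
  carrier := {f | ∃ a ∈ R, ∃ b ∈ R, IsUnit b ∧ f * b = a}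
  zero_mem' := ⟨0, R.zero_mem, 1, R.one_mem, isUnit_one, zero_mul 1⟩
  one_mem' := ⟨1, R.one_mem, 1, R.one_mem, isUnit_one, one_mul 1⟩
  neg_mem' := by
    rintro f ⟨a, ha, b, hb, hb_unit, rfl⟩
    exact ⟨_, R.neg_mem ha, b, hb, hb_unit, neg_mul f b⟩
  add_mem' := by
    rintro f g ⟨a, ha, b, hb, hb_unit, rfl⟩ ⟨c, hc, d, hd, hd_unit, rfl⟩
    exact ⟨_, R.add_mem (R.mul_mem ha hd) (R.mul_mem hc hb), _, R.mul_mem hb hd,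
      hb_unit.mul hd_unit, by ring⟩
  mul_mem' := by
    rintro f g ⟨a, ha, b, hb, hb_unit, rfl⟩ ⟨c, hc, d, hd, hd_unit, rfl⟩
    exact ⟨_, R.mul_mem ha hc, _, R.mul_mem hb hd, hb_unit.mul hd_unit, by ring⟩

theorem le_fractionSubring (R : Subring A) : R ≤ fractionSubring R :=
  fun a ha ↦ ⟨a, ha, 1, R.one_mem, isUnit_one, mul_one a⟩

theorem isField_fractionSubring [Nontrivial A] {R : Subring A}
    (hR : ∀ a ∈ R, a ≠ 0 → IsUnit a) : IsField (fractionSubring R) where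
  exists_pair_ne := ⟨0, 1, zero_ne_one⟩
  mul_comm := mul_comm
  mul_inv_cancel := by
    rintro ⟨f, a, ha, b, hb, hb_unit, hfb⟩ hf
    have ha_ne : a ≠ 0 := by
      rintro rfl
      exact hf (Subtype.ext (hb_unit.mul_left_eq_zero.mp hfb))
    obtain ⟨c, hc⟩ := (hR a ha ha_ne).exists_right_inv
    have h_inv : b * c * a = b := by rw [mul_assoc, mul_comm c, hc, mul_one]
    exact ⟨⟨b * c, b, hb, a, ha, hR a ha ha_ne, h_inv⟩,
      Subtype.ext (by rw [Subring.coe_mul, ← mul_assoc, hfb, hc]; rfl)⟩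

theorem isUnit_of_mem_of_isField {K : Subring A} (hK : IsField K) {a : A} (ha : a ∈ K)
    (ha_ne : a ≠ 0) : IsUnit a := by
  obtain ⟨b, hb⟩ := hK.mul_inv_cancel (a := ⟨a, ha⟩) (by simpa [Subtype.ext_iff] using ha_ne)
  exact IsUnit.of_mul_eq_one (b : A) (congrArg Subtype.val hb)

variable [PartialOrder A]

/-- A partially ordered ring has bounded inversion if every element `x ≥ 1` is a unit with
nonnegative inverse; rings of germs of real functions are the intended example. -/
def BoundedInversion (A : Type*) [CommRing A] [PartialOrder A] : Prop :=
  ∀ x : A, 1 ≤ x → ∃ u, 0 ≤ u ∧ x * u = 1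

variable [IsOrderedRing A]

theorem exists_mul_aeval_mul_eq_one (hA : BoundedInversion A) {K : Subring A} (hK : IsField K)
    {y : A} (hy : ∀ a ∈ K, a ≤ y) {p : K[X]} (hp : p ≠ 0) :
    ∃ c : K, ∃ u : A, 0 ≤ u ∧ u ≤ 1 ∧ c * aeval y p * u = 1 := by
  obtain ⟨c, hc⟩ := hK.mul_inv_cancel (leadingCoeff_ne_zero.mpr hp)
  have h_monic : (C c * p).Monic :=
    monic_C_mul_of_mul_leadingCoeff_eq_one (by rw [mul_comm, hc])
  have h_one_le : 1 ≤ aeval y (C c * p) := one_le_aeval_of_monic (fun a : K ↦ hy a a.2) h_monic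
  obtain ⟨u, hu_nonneg, hu⟩ := hA _ h_one_le
  refine ⟨c, u, hu_nonneg, hu ▸ le_mul_of_one_le_left hu_nonneg h_one_le, ?_⟩
  rw [← hu, map_mul, aeval_C]
  rfl

theorem exists_isField_extension [Nontrivial A] (hA : BoundedInversion A) {K : Subring A}
    (hK : IsField K) {y : A} (hy : ∀ a ∈ K, a ≤ y) :
    ∃ L : Subring A, IsField L ∧ K ≤ L ∧ y ∈ L ∧ ∀ f ∈ L, ∃ m : ℕ, f ≤ y ^ m := by
  let R : Subring A := (aeval y : K[X] →ₐ[K] A).range.toSubring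
  have hKR : K ≤ R := fun a ha ↦ ⟨C ⟨a, ha⟩, aeval_C y _⟩
  have hyR : y ∈ R := ⟨X, aeval_X y⟩
  refine ⟨fractionSubring R, isField_fractionSubring ?_, hKR.trans (le_fractionSubring R),
    le_fractionSubring R hyR, ?_⟩
  · rintro _ ⟨p, rfl⟩ hp
    obtain ⟨c, u, -, -, h_inv⟩ := exists_mul_aeval_mul_eq_one hA hK hy (p := p)
      (by rintro rfl; exact hp (map_zero _))
    change IsUnit (aeval y p)
    exact IsUnit.of_mul_eq_one (c * u) (by rw [← h_inv]; ring)
  · rintro f ⟨_, ⟨p, rfl⟩, _, ⟨q, rfl⟩, hq_unit, hfq⟩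
    obtain ⟨c, u, hu_nonneg, hu_le, h_inv⟩ := exists_mul_aeval_mul_eq_one hA hK hy (p := q)
      (by rintro rfl; exact hq_unit.ne_zero (map_zero _))
    change f * aeval y q = aeval y p at hfq
    have hy_nonneg : 0 ≤ y := hy 0 K.zero_mem
    have hf : f = aeval y (C c * p) * u := by
      calc f = f * (c * aeval y q * u) := by rw [h_inv, mul_one]
        _ = c * (f * aeval y q) * u := by ring
        _ = aeval y (C c * p) * u := by rw [hfq, map_mul, aeval_C]; rfl
    refine ⟨(C c * p).natDegree + 1, ?_⟩
    calc f = aeval y (C c * p) * u := hf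
      _ ≤ y ^ ((C c * p).natDegree + 1) * u := by
        gcongr
        exact aeval_le_pow (fun a : K ↦ hy a a.2) _
      _ ≤ y ^ ((C c * p).natDegree + 1) := mul_le_of_le_one_right (by positivity) hu_le

theorem exists_isField_tower [Nontrivial A] (hA : BoundedInversion A) {H : Subring A}
    (hH : IsField H) (n : ℕ) {y : ℕ → A} (hy_pow : ∀ k m, y (k + 1) ^ m ≤ y k)
    (hHy : ∀ k, ∀ a ∈ H, a ≤ y k) :
    ∃ K : Subring A, IsField K ∧ H ≤ K ∧ (∀ i < n, y i ∈ K) ∧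
      ∀ f ∈ K, ∃ m : ℕ, f ≤ y 0 ^ m := by
  -- The largest element `y 0` is adjoined last, so the induction runs along the shifted sequence.
  induction n generalizing y with
  | zero => exact ⟨H, hH, le_rfl, by simp, fun f hf ↦ ⟨1, by simpa using hHy 0 f hf⟩⟩
  | succ n ih =>
    obtain ⟨K, hK, hHK, hyK, hK_le⟩ := ih (fun k ↦ hy_pow (k + 1)) (fun k ↦ hHy (k + 1))
    have hKy : ∀ f ∈ K, f ≤ y 0 := fun f hf ↦
      have ⟨m, hm⟩ := hK_le f hf
      hm.trans (hy_pow 0 m)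
    obtain ⟨L, hL, hKL, hyL, hL_le⟩ := exists_isField_extension hA hK hKy
    refine ⟨L, hL, hHK.trans hKL, ?_, hL_le⟩
    rintro (_ | i) hi
    exacts [hyL, hKL (hyK i (by omega))]

theorem isUnit_of_mem_closure_union_range [Nontrivial A] (hA : BoundedInversion A)
    {H : Subring A} (hH : IsField H) {y : ℕ → A} (hy_pow : ∀ k m, y (k + 1) ^ m ≤ y k)
    (hHy : ∀ k, ∀ a ∈ H, a ≤ y k) {f : A}
    (hf : f ∈ Subring.closure (H ∪ Set.range y)) (hf_ne : f ≠ 0) : IsUnit f := by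
  let L (n : ℕ) : Subring A := Subring.closure (H ∪ y '' Set.Iio n)
  have hL_mono : Monotone L := fun m n hmn ↦ by
    dsimp only [L]
    gcongr
  have h_le : Subring.closure (H ∪ Set.range y) ≤ ⨆ n, L n := by
    refine Subring.closure_le.mpr (Set.union_subset ?_ ?_)
    · exact fun a ha ↦ le_iSup L 0 (Subring.subset_closure (.inl ha))
    · rintro _ ⟨k, rfl⟩
      exact le_iSup L (k + 1) (Subring.subset_closure (.inr ⟨k, k.lt_succ_self, rfl⟩))
  obtain ⟨n, hfn⟩ := (Subring.mem_iSup_of_directed hL_mono.directed_le).mp (h_le hf)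
  obtain ⟨K, hK, hHK, hyK, -⟩ := exists_isField_tower hA hH n hy_pow hHy
  have hLK : L n ≤ K := Subring.closure_le.mpr
    (Set.union_subset hHK (Set.image_subset_iff.mpr hyK))
  exact isUnit_of_mem_of_isField hK (hLK hfn) hf_ne

end OrderedRing

section Germs

theorem boundedInversion_germ {α 𝕜 : Type*} [Field 𝕜] [LinearOrder 𝕜] [IsStrictOrderedRing 𝕜]
    (l : Filter α) : BoundedInversion (Germ l 𝕜) := by
  intro x hx
  induction x using Germ.inductionOn with | _ f
  have hf : ∀ᶠ t in l, 0 < f t :=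
    (Germ.coe_le.mp hx).mono fun t ht ↦ zero_lt_one.trans_le ht
  exact ⟨((f⁻¹ : α → 𝕜) : Germ l 𝕜), Germ.coe_le.mpr (hf.mono fun t ht ↦ inv_nonneg.mpr ht.le),
    Germ.coe_eq.mpr (hf.mono fun t ht ↦ mul_inv_cancel₀ ht.ne')⟩

namespace GermHasDeriv

variable {f f' g g' : GermsAtInfinity}

theorem const (c : ℝ) : GermHasDeriv ((fun _ : ℝ ↦ c : ℝ → ℝ) : GermsAtInfinity) 0 :=
  ⟨_, 0, rfl, rfl, .of_forall fun t ↦ hasDerivAt_const t c⟩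

theorem neg : GermHasDeriv f f' → GermHasDeriv (-f) (-f') := by
  rintro ⟨φ, φ', rfl, rfl, hφ⟩
  exact ⟨-φ, -φ', rfl, rfl, hφ.mono fun t ht ↦ ht.neg⟩

theorem add : GermHasDeriv f f' → GermHasDeriv g g' → GermHasDeriv (f + g) (f' + g') := by
  rintro ⟨φ, φ', rfl, rfl, hφ⟩ ⟨ψ, ψ', rfl, rfl, hψ⟩
  exact ⟨φ + ψ, φ' + ψ', rfl, rfl, by filter_upwards [hφ, hψ] with t h₁ h₂ using h₁.add h₂⟩

theorem mul : GermHasDeriv f f' → GermHasDeriv g g' →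
    GermHasDeriv (f * g) (f' * g + f * g') := by
  rintro ⟨φ, φ', rfl, rfl, hφ⟩ ⟨ψ, ψ', rfl, rfl, hψ⟩
  exact ⟨φ * ψ, φ' * ψ + φ * ψ', rfl, rfl,
    by filter_upwards [hφ, hψ] with t h₁ h₂ using h₁.mul h₂⟩

theorem of_mul_eq_one (hf : GermHasDeriv f f') (hfg : f * g = 1) :
    GermHasDeriv g (-(f' * (g * g))) := by
  obtain ⟨φ, φ', rfl, rfl, hφ⟩ := hf
  induction g using Germ.inductionOn with | _ γ
  have hφγ : ∀ᶠ t in atTop, φ t * γ t = 1 := Germ.coe_eq.mp hfg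
  refine ⟨φ⁻¹, -(φ' * (γ * γ)), Germ.coe_eq.mpr ?_, rfl, ?_⟩
  · exact hφγ.mono fun t ht ↦ eq_inv_of_mul_eq_one_right ht
  · filter_upwards [hφ, hφγ] with t h_deriv ht
    refine (h_deriv.inv (left_ne_zero_of_mul_eq_one ht)).congr_deriv ?_
    rw [Pi.neg_apply, Pi.mul_apply, Pi.mul_apply, eq_inv_of_mul_eq_one_right ht]
    ring

theorem nonneg_or_nonpos (hf : GermHasDeriv f f') (hf_unit : IsUnit f) : 0 ≤ f ∨ f ≤ 0 := by
  obtain ⟨φ, φ', rfl, rfl, hφ⟩ := hf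
  obtain ⟨g, hg⟩ := hf_unit.exists_right_inv
  induction g using Germ.inductionOn with | _ γ
  have hφγ : ∀ᶠ t in atTop, φ t * γ t = 1 := Germ.coe_eq.mp hg
  obtain ⟨a, ha⟩ := eventually_atTop.mp (hφ.and hφγ)
  have hφ_cont : ContinuousOn φ (Set.Ici a) := fun t ht ↦
    (ha t ht).1.continuousAt.continuousWithinAt
  have hφ_ne (t : ℝ) (ht : a ≤ t) : φ t ≠ 0 := left_ne_zero_of_mul_eq_one (ha t ht).2
  by_contra! h_not
  obtain ⟨t, ht, ht_neg⟩ : ∃ t ≥ a, φ t < 0 := by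
    by_contra! h_nonneg
    exact h_not.1 (Germ.coe_le.mpr (eventually_atTop.mpr ⟨a, h_nonneg⟩))
  obtain ⟨s, hs, hs_pos⟩ : ∃ s ≥ a, 0 < φ s := by
    by_contra! h_nonpos
    exact h_not.2 (Germ.coe_le.mpr (eventually_atTop.mpr ⟨a, h_nonpos⟩))
  obtain ⟨r, hr, hr_zero⟩ := isPreconnected_Ici.intermediate_value ht hs hφ_cont
    ⟨ht_neg.le, hs_pos.le⟩
  exact hφ_ne r hr hr_zero

theorem exists_mem_closure {s : Set GermsAtInfinity}
    (hs : ∀ f ∈ s, ∃ f' ∈ Subring.closure s, GermHasDeriv f f') (hf : f ∈ Subring.closure s) :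
    ∃ f' ∈ Subring.closure s, GermHasDeriv f f' := by
  induction hf using Subring.closure_induction with
  | mem f hf => exact hs f hf
  | zero => exact ⟨0, zero_mem _, const 0⟩
  | one => exact ⟨0, zero_mem _, const 1⟩
  | add f g _ _ hf hg =>
    obtain ⟨f', hf'_mem, hf'⟩ := hf
    obtain ⟨g', hg'_mem, hg'⟩ := hg
    exact ⟨_, add_mem hf'_mem hg'_mem, hf'.add hg'⟩
  | neg f _ hf =>
    obtain ⟨f', hf'_mem, hf'⟩ := hf
    exact ⟨_, neg_mem hf'_mem, hf'.neg⟩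
  | mul f g hf_mem hg_mem hf hg =>
    obtain ⟨f', hf'_mem, hf'⟩ := hf
    obtain ⟨g', hg'_mem, hg'⟩ := hg
    exact ⟨_, add_mem (mul_mem hf'_mem hg_mem) (mul_mem hf_mem hg'_mem), hf'.mul hg'⟩

end GermHasDeriv

theorem isHardyField_fractionSubring {R : Subring GermsAtInfinity}
    (hR_unit : ∀ f ∈ R, f ≠ 0 → IsUnit f)
    (hR_deriv : ∀ f ∈ R, ∃ f' ∈ R, GermHasDeriv f f') : IsHardyField (fractionSubring R) where
  isField := isField_fractionSubring hR_unit
  exists_deriv := by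
    rintro f ⟨a, ha, b, hb, hb_unit, hfb⟩
    obtain ⟨a', ha'_mem, ha'⟩ := hR_deriv a ha
    obtain ⟨b', hb'_mem, hb'⟩ := hR_deriv b hb
    obtain ⟨c, hc⟩ := hb_unit.exists_right_inv
    obtain rfl : f = a * c := by rw [← hfb, mul_assoc, hc, mul_one]
    refine ⟨_, ⟨a' * b - a * b', ?_, b * b, R.mul_mem hb hb, hb_unit.mul hb_unit, ?_⟩,
      ha'.mul (hb'.of_mul_eq_one hc)⟩
    · exact R.sub_mem (R.mul_mem ha'_mem hb) (R.mul_mem ha hb'_mem)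
    · linear_combination (a' * b - a * b' * (b * c + 1)) * hc

namespace IsHardyField

variable {H : Subring GermsAtInfinity}

theorem le_total (hH : IsHardyField H) {f g : GermsAtInfinity} (hf : f ∈ H) (hg : g ∈ H) :
    f ≤ g ∨ g ≤ f := by
  have h_mem : g - f ∈ H := H.sub_mem hg hf
  obtain h_zero | h_ne := eq_or_ne (g - f) 0
  · exact .inl (sub_eq_zero.mp h_zero).ge
  · obtain ⟨_, -, h_deriv⟩ := hH.exists_deriv _ h_mem
    simpa only [sub_nonneg, sub_nonpos] using
      h_deriv.nonneg_or_nonpos (isUnit_of_mem_of_isField hH.isField h_mem h_ne)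

/-- The order of a Hardy field, inherited from the partial order on germs, as a linear order. -/
noncomputable abbrev linearOrder (hH : IsHardyField H) : LinearOrder H where
  __ := (inferInstance : PartialOrder H)
  le_total f g := hH.le_total f.2 g.2
  toDecidableLE := Classical.decRel _

end IsHardyField

end Germs

section LogDeriv

theorem tendsto_atTop_of_le_deriv {f f' : ℝ → ℝ} {C : ℝ} (hC : 0 < C)
    (hf : ∀ᶠ t in atTop, HasDerivAt f (f' t) t) (hf' : ∀ᶠ t in atTop, C ≤ f' t) :
    Tendsto f atTop atTop := by
  obtain ⟨a, ha⟩ := eventually_atTop.mp (hf.and hf')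
  have h_deriv (t : ℝ) (ht : a ≤ t) : HasDerivAt f (f' t) t := (ha t ht).1
  refine tendsto_atTop_mono' atTop (f₁ := fun t ↦ f a + C * (t - a)) ?_ ?_
  · filter_upwards [eventually_ge_atTop a] with t ht
    have h_mean := (convex_Ici a).mul_sub_le_image_sub_of_le_deriv
      (fun s hs ↦ (h_deriv s hs).continuousAt.continuousWithinAt)
      (fun s hs ↦ (h_deriv s (interior_subset hs)).differentiableAt.differentiableWithinAt)
      (fun s hs ↦ (ha s (interior_subset hs)).2.trans_eq
        (h_deriv s (interior_subset hs)).deriv.symm) a Set.self_mem_Ici t ht ht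
    linarith
  · exact tendsto_atTop_add_const_left _ _
      ((tendsto_atTop_add_const_right _ (-a) tendsto_id).const_mul_atTop hC)

theorem tendsto_div_atTop_of_logDeriv {u v p q : ℝ → ℝ} {C : ℝ} (hC : 0 < C)
    (hu_pos : ∀ᶠ t in atTop, 0 < u t) (hu : ∀ᶠ t in atTop, HasDerivAt u (u t * p t) t)
    (hv_pos : ∀ᶠ t in atTop, 0 < v t) (hv : ∀ᶠ t in atTop, HasDerivAt v (v t * q t) t)
    (hpq : ∀ᶠ t in atTop, q t + C ≤ p t) : Tendsto (u / v) atTop atTop := by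
  have h_log : Tendsto (fun t ↦ Real.log (u t) - Real.log (v t)) atTop atTop := by
    refine tendsto_atTop_of_le_deriv hC (f' := p - q) ?_
      (hpq.mono fun t ht ↦ le_sub_iff_add_le'.mpr ht)
    filter_upwards [hu_pos, hu, hv_pos, hv] with t hu_pos hu hv_pos hv
    refine ((hu.log hu_pos.ne').sub (hv.log hv_pos.ne')).congr_deriv ?_
    rw [mul_div_cancel_left₀ _ hu_pos.ne', mul_div_cancel_left₀ _ hv_pos.ne', Pi.sub_apply]
  refine (Real.tendsto_exp_atTop.comp h_log).congr' ?_
  filter_upwards [hu_pos, hv_pos] with t hu_pos hv_pos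
  rw [Function.comp_apply, Real.exp_sub, Real.exp_log hu_pos, Real.exp_log hv_pos, Pi.div_apply]

/-- A sequence of functions in which `y (k + 1)` is the logarithmic derivative of `y k`, and each
function is at least twice the next one, so that the growth rates decrease along the sequence. -/
structure IsLogDerivChain (y : ℕ → ℝ → ℝ) : Prop where
  two_le : ∀ k, ∀ᶠ t in atTop, 2 ≤ y k t
  hasDerivAt : ∀ k, ∀ᶠ t in atTop, HasDerivAt (y k) (y k t * y (k + 1) t) t
  two_mul_succ_le : ∀ k, ∀ᶠ t in atTop, 2 * y (k + 1) t ≤ y k t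

namespace IsLogDerivChain

variable {y : ℕ → ℝ → ℝ}

theorem eventually_pos (hy : IsLogDerivChain y) (k : ℕ) : ∀ᶠ t in atTop, 0 < y k t :=
  (hy.two_le k).mono fun _ ht ↦ two_pos.trans_le ht

theorem eventually_mul_succ_le (hy : IsLogDerivChain y) (k : ℕ) (M : ℝ) :
    ∀ᶠ t in atTop, M * y (k + 1) t ≤ y k t := by
  have h_div : Tendsto (y k / y (k + 1)) atTop atTop := by
    refine tendsto_div_atTop_of_logDeriv two_pos (hy.eventually_pos k) (hy.hasDerivAt k)
      (hy.eventually_pos (k + 1)) (hy.hasDerivAt (k + 1)) ?_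
    filter_upwards [hy.two_mul_succ_le (k + 1), hy.two_le (k + 2)] with t h₁ h₂
    linarith
  filter_upwards [h_div.eventually_ge_atTop M, hy.eventually_pos (k + 1)] with t ht h_pos
  exact (le_div_iff₀ h_pos).mp ht

theorem eventually_succ_pow_le (hy : IsLogDerivChain y) (k m : ℕ) :
    ∀ᶠ t in atTop, y (k + 1) t ^ m ≤ y k t := by
  have h_pow_pos : ∀ᶠ t in atTop, 0 < y (k + 1) t ^ m :=
    (hy.eventually_pos (k + 1)).mono fun t ht ↦ pow_pos ht m
  have h_pow_deriv : ∀ᶠ t in atTop,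
      HasDerivAt (fun t ↦ y (k + 1) t ^ m) (y (k + 1) t ^ m * (m * y (k + 2) t)) t := by
    filter_upwards [hy.hasDerivAt (k + 1)] with t ht
    refine (ht.fun_pow m).congr_deriv ?_
    cases m with
    | zero => simp
    | succ m => rw [Nat.add_sub_cancel]; ring
  have h_div : Tendsto (y k / fun t ↦ y (k + 1) t ^ m) atTop atTop := by
    refine tendsto_div_atTop_of_logDeriv two_pos (hy.eventually_pos k) (hy.hasDerivAt k)
      h_pow_pos h_pow_deriv ?_
    filter_upwards [hy.eventually_mul_succ_le (k + 1) (m + 1), hy.two_le (k + 2)] with t h₁ h₂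
    linarith
  filter_upwards [h_div.eventually_ge_atTop 1, h_pow_pos] with t ht h_pos
  exact (one_le_div h_pos).mp ht

theorem exists_isHardyField_extension {H : Subring GermsAtInfinity} (hH : IsHardyField H)
    (hy : IsLogDerivChain y) (hHy : ∀ k, ∀ f ∈ H, f ≤ (y k : GermsAtInfinity)) :
    ∃ K, IsHardyField K ∧ H ≤ K ∧ ∀ k, (y k : GermsAtInfinity) ∈ K := by
  let Y (k : ℕ) : GermsAtInfinity := y k
  let S : Set GermsAtInfinity := H ∪ Set.range Y
  have hY_mem (k : ℕ) : Y k ∈ Subring.closure S := Subring.subset_closure (.inr ⟨k, rfl⟩)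
  have hY_pow (k m : ℕ) : Y (k + 1) ^ m ≤ Y k :=
    Germ.coe_le.mpr (hy.eventually_succ_pow_le k m)
  have hS_deriv : ∀ f ∈ S, ∃ f' ∈ Subring.closure S, GermHasDeriv f f' := by
    rintro f (hf | ⟨k, rfl⟩)
    · obtain ⟨f', hf'_mem, hf'⟩ := hH.exists_deriv f hf
      exact ⟨f', Subring.subset_closure (.inl hf'_mem), hf'⟩
    · exact ⟨Y k * Y (k + 1), mul_mem (hY_mem k) (hY_mem (k + 1)), _, _, rfl, rfl,
        hy.hasDerivAt k⟩
  refine ⟨fractionSubring (Subring.closure S), isHardyField_fractionSubring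
    (fun f ↦ isUnit_of_mem_closure_union_range (boundedInversion_germ _) hH.isField hY_pow hHy)
    (fun f ↦ GermHasDeriv.exists_mem_closure hS_deriv),
    fun f hf ↦ le_fractionSubring _ (Subring.subset_closure (.inl hf)),
    fun k ↦ le_fractionSubring _ (hY_mem k)⟩

end IsLogDerivChain

end LogDeriv

section Construction

/-- One step of the Picard iteration for the system `y k' = y k * y (k + 1)` with prescribed values
`s k` on `(-∞, k]`. -/
noncomputable def picardStep (s z : ℕ → ℝ → ℝ) (k : ℕ) (x : ℝ) : ℝ :=
  s k (min x k) * Real.exp (∫ t in (k : ℝ)..max x k, z (k + 1) t)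

theorem continuous_picardStep {s z : ℕ → ℝ → ℝ} (hs : ∀ k, Continuous (s k))
    (hz : ∀ k, Continuous (z k)) (k : ℕ) : Continuous (picardStep s z k) := by
  have h_int : Continuous fun x : ℝ ↦ ∫ t in (k : ℝ)..x, z (k + 1) t :=
    intervalIntegral.continuous_primitive (fun _ _ ↦ (hz (k + 1)).intervalIntegrable _ _) _
  have h_comp : Continuous fun x : ℝ ↦ ∫ t in (k : ℝ)..max x k, z (k + 1) t :=
    h_int.comp (continuous_id.max continuous_const)
  have h_seed : Continuous fun x : ℝ ↦ s k (min x k) :=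
    (hs k).comp (continuous_id.min continuous_const)
  exact h_seed.mul h_comp.rexp

theorem picardStep_of_le (s z : ℕ → ℝ → ℝ) {k : ℕ} {x : ℝ} (hx : x ≤ k) :
    picardStep s z k x = s k x := by
  rw [picardStep, min_eq_left hx, max_eq_right hx, intervalIntegral.integral_same, Real.exp_zero,
    mul_one]

theorem picardStep_of_ge (s z : ℕ → ℝ → ℝ) {k : ℕ} {x : ℝ} (hx : k ≤ x) :
    picardStep s z k x = s k k * Real.exp (∫ t in (k : ℝ)..x, z (k + 1) t) := by
  rw [picardStep, min_eq_right hx, max_eq_left hx]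

theorem picardStep_congr {s z w : ℕ → ℝ → ℝ} {k : ℕ} {x : ℝ}
    (hzw : ∀ t ∈ Set.Icc (k : ℝ) x, z (k + 1) t = w (k + 1) t) :
    picardStep s z k x = picardStep s w k x := by
  obtain hx | hx := le_total x k
  · rw [picardStep_of_le s z hx, picardStep_of_le s w hx]
  · rw [picardStep_of_ge s z hx, picardStep_of_ge s w hx, intervalIntegral.integral_congr
      fun t ht ↦ hzw t (Set.uIcc_of_le hx ▸ ht)]

theorem picardStep_iterate_succ_eq (s : ℕ → ℝ → ℝ) (n : ℕ) {k : ℕ} {x : ℝ} (hx : x ≤ k + n) :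
    (picardStep s)^[n + 1] s k x = (picardStep s)^[n] s k x := by
  induction n generalizing k x with
  | zero => exact picardStep_of_le s s (by simpa using hx)
  | succ n ih =>
    simp only [Function.iterate_succ_apply'] at ih ⊢
    refine picardStep_congr fun t ht ↦ ?_
    exact ih (k := k + 1) (x := t) (by push_cast at hx ⊢; linarith [ht.2])

theorem picardStep_iterate_eq (s : ℕ → ℝ → ℝ) {n m : ℕ} (hnm : n ≤ m) {k : ℕ} {x : ℝ}
    (hx : x ≤ k + n) : (picardStep s)^[m] s k x = (picardStep s)^[n] s k x := by
  induction m, hnm using Nat.le_induction with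
  | base => rfl
  | succ m hnm ih =>
    rw [picardStep_iterate_succ_eq s m (hx.trans (by gcongr)), ih]

theorem exists_isFixedPt_picardStep {s : ℕ → ℝ → ℝ} (hs : ∀ k, Continuous (s k)) :
    ∃ y : ℕ → ℝ → ℝ, (∀ k, Continuous (y k)) ∧ Function.IsFixedPt (picardStep s) y := by
  let y (k : ℕ) (x : ℝ) : ℝ := (picardStep s)^[⌈x⌉₊] s k x
  have hy_eq {n : ℕ} {x : ℝ} (hx : x ≤ n) (k : ℕ) : y k x = (picardStep s)^[n] s k x :=
    (picardStep_iterate_eq s (Nat.ceil_le.mpr hx)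
      ((Nat.le_ceil x).trans (le_add_of_nonneg_left k.cast_nonneg))).symm
  have h_cont (n : ℕ) : ∀ k, Continuous ((picardStep s)^[n] s k) := by
    induction n with
    | zero => exact hs
    | succ n ih =>
      rw [Function.iterate_succ_apply']
      exact continuous_picardStep hs ih
  refine ⟨y, fun k ↦ continuous_iff_continuousAt.mpr fun x ↦ ?_, ?_⟩
  · obtain ⟨n, hn⟩ := exists_nat_gt x
    refine (h_cont n k).continuousAt.congr ?_
    filter_upwards [eventually_lt_nhds hn] with t ht using (hy_eq ht.le k).symm
  · ext k x
    rw [hy_eq ((Nat.le_ceil x).trans (Nat.cast_le.mpr ⌈x⌉₊.le_succ)) k,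
      Function.iterate_succ_apply']
    exact picardStep_congr fun t ht ↦ hy_eq (ht.2.trans (Nat.le_ceil x)) (k + 1)

section FixedPoint

variable {s y : ℕ → ℝ → ℝ} (hy : Function.IsFixedPt (picardStep s) y)

include hy

theorem eq_of_isFixedPt_picardStep_of_le {k : ℕ} {x : ℝ} (hx : x ≤ k) : y k x = s k x := by
  rw [← picardStep_of_le s y hx, hy.eq]

theorem eq_mul_exp_integral_of_isFixedPt_picardStep {k : ℕ} {x : ℝ} (hx : k ≤ x) :
    y k x = s k k * Real.exp (∫ t in (k : ℝ)..x, y (k + 1) t) := by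
  rw [← picardStep_of_ge s y hx, hy.eq]

theorem eq_mul_exp_integral_of_isFixedPt_picardStep_of_le (hy_cont : ∀ k, Continuous (y k)) {k : ℕ}
    {a x : ℝ} (ha : k ≤ a) (hax : a ≤ x) :
    y k x = y k a * Real.exp (∫ t in a..x, y (k + 1) t) := by
  rw [eq_mul_exp_integral_of_isFixedPt_picardStep hy ha,
    eq_mul_exp_integral_of_isFixedPt_picardStep hy (ha.trans hax), mul_assoc, ← Real.exp_add,
    intervalIntegral.integral_add_adjacent_intervals]
  all_goals exact (hy_cont (k + 1)).intervalIntegrable _ _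

theorem hasDerivAt_of_isFixedPt_picardStep (hy_cont : ∀ k, Continuous (y k)) {k : ℕ} {x : ℝ}
    (hx : k < x) : HasDerivAt (y k) (y k x * y (k + 1) x) x := by
  have h_int : HasDerivAt (fun x ↦ ∫ t in (k : ℝ)..x, y (k + 1) t) (y (k + 1) x) x :=
    ((hy_cont (k + 1)).integral_hasStrictDerivAt k x).hasDerivAt
  rw [eq_mul_exp_integral_of_isFixedPt_picardStep hy hx.le, mul_assoc]
  refine (h_int.exp.const_mul (s k k)).congr_of_eventuallyEq ?_
  filter_upwards [eventually_gt_nhds hx] with t ht using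
    eq_mul_exp_integral_of_isFixedPt_picardStep hy ht.le

theorem pos_of_isFixedPt_picardStep (hs : ∀ k x, 0 < s k x) (k : ℕ) (x : ℝ) : 0 < y k x := by
  rw [← hy.eq]
  exact mul_pos (hs _ _) (Real.exp_pos _)

end FixedPoint

/-- The solution on `(-∞, k]` of `u' = u ^ 2` with `u k = b k`, extended by reflection to `[k, ∞)`.
It rises from at most `1` at `k - 1` to the possibly huge value `b k` at `k`. -/
noncomputable def steepSeed (b : ℕ → ℝ) (k : ℕ) (x : ℝ) : ℝ :=
  ((b k)⁻¹ + |k - x|)⁻¹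

section SteepSeed

variable {b : ℕ → ℝ}

theorem steepSeed_self (b : ℕ → ℝ) (k : ℕ) : steepSeed b k k = b k := by
  rw [steepSeed, sub_self, abs_zero, add_zero, inv_inv]

theorem steepSeed_pos (hb : ∀ k, 0 < b k) (k : ℕ) (x : ℝ) : 0 < steepSeed b k x :=
  inv_pos.mpr (add_pos_of_pos_of_nonneg (inv_pos.mpr (hb k)) (abs_nonneg _))

theorem continuous_steepSeed (hb : ∀ k, 0 < b k) (k : ℕ) : Continuous (steepSeed b k) :=
  Continuous.inv₀ (by fun_prop) fun x ↦ (inv_pos.mp (steepSeed_pos hb k x)).ne'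

theorem steepSeed_succ_le_one (hb : ∀ k, 0 < b k) (k : ℕ) : steepSeed b (k + 1) k ≤ 1 := by
  refine inv_le_one_of_one_le₀ ?_
  rw [Nat.cast_succ, add_sub_cancel_left, abs_one]
  exact le_add_of_nonneg_left (inv_pos.mpr (hb _)).le

theorem integral_steepSeed (hb : ∀ k, 0 < b k) {k : ℕ} {x y : ℝ} (hx : x ≤ k) (hy : y ≤ k) :
    ∫ t in x..y, steepSeed b k t =
      Real.log (steepSeed b k y) - Real.log (steepSeed b k x) := by
  have h_le {t : ℝ} (ht : t ∈ Set.uIcc x y) : t ≤ k := ht.2.trans (max_le hx hy)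
  have h_eq {t : ℝ} (ht : t ≤ k) : steepSeed b k t = ((b k)⁻¹ + (k - t))⁻¹ := by
    rw [steepSeed, abs_of_nonneg (sub_nonneg.mpr ht)]
  have h_log {t : ℝ} (ht : t ≤ k) :
      Real.log (steepSeed b k t) = -Real.log ((b k)⁻¹ + (k - t)) := by
    rw [h_eq ht, Real.log_inv]
  rw [h_log hx, h_log hy]
  refine intervalIntegral.integral_eq_sub_of_hasDerivAt
    (f := fun t ↦ -Real.log ((b k)⁻¹ + (k - t))) (fun t ht ↦ ?_)
    ((continuous_steepSeed hb k).intervalIntegrable _ _)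
  have h_pos : 0 < (b k)⁻¹ + (k - t) :=
    add_pos_of_pos_of_nonneg (inv_pos.mpr (hb k)) (sub_nonneg.mpr (h_le ht))
  have h_base : HasDerivAt (fun t ↦ (b k)⁻¹ + (k - t)) (-1) t :=
    ((hasDerivAt_id t).const_sub (k : ℝ)).const_add (b k)⁻¹
  refine (h_base.log h_pos.ne').neg.congr_deriv ?_
  rw [h_eq (h_le ht), neg_div, neg_neg, one_div]

theorem two_mul_steepSeed_succ_le (hb : ∀ k, 2 ≤ b k) {k : ℕ} {x : ℝ} (hx : x ≤ k + 1) :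
    2 * steepSeed b (k + 1) x ≤
      b k * Real.exp (∫ t in (k : ℝ)..x, steepSeed b (k + 1) t) := by
  have hb_pos (k : ℕ) : 0 < b k := two_pos.trans_le (hb k)
  have hs_pos := steepSeed_pos hb_pos (k + 1)
  rw [integral_steepSeed hb_pos (by simp) (by simpa using hx), Real.exp_sub,
    Real.exp_log (hs_pos x), Real.exp_log (hs_pos k), ← mul_div_assoc, le_div_iff₀ (hs_pos k)]
  calc 2 * steepSeed b (k + 1) x * steepSeed b (k + 1) k ≤ 2 * steepSeed b (k + 1) x * 1 := by
        gcongr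
        · exact (mul_pos two_pos (hs_pos x)).le
        · exact steepSeed_succ_le_one hb_pos k
    _ ≤ b k * steepSeed b (k + 1) x := by
        rw [mul_one]
        exact mul_le_mul_of_nonneg_right (hb k) (hs_pos x).le

variable {y : ℕ → ℝ → ℝ}

section FixedPoint

variable (hy : Function.IsFixedPt (picardStep (steepSeed b)) y)

include hy

theorem two_mul_succ_le_of_isFixedPt_steepSeed_of_le (hb : ∀ k, 2 ≤ b k) {k : ℕ} {x : ℝ}
    (hkx : k ≤ x) (hx : x ≤ k + 1) : 2 * y (k + 1) x ≤ y k x := by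
  have h_seed {t : ℝ} (ht : t ≤ k + 1) : y (k + 1) t = steepSeed b (k + 1) t :=
    eq_of_isFixedPt_picardStep_of_le hy (by simpa using ht)
  have h_int : ∫ t in (k : ℝ)..x, y (k + 1) t = ∫ t in (k : ℝ)..x, steepSeed b (k + 1) t :=
    intervalIntegral.integral_congr fun t ht ↦
      h_seed ((Set.uIcc_of_le hkx ▸ ht).2.trans hx)
  rw [h_seed hx, eq_mul_exp_integral_of_isFixedPt_picardStep hy hkx, h_int, steepSeed_self]
  exact two_mul_steepSeed_succ_le hb hx

variable (hy_cont : ∀ k, Continuous (y k))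

include hy_cont

theorem two_mul_succ_le_of_isFixedPt_steepSeed (hb : ∀ k, 2 ≤ b k) {k : ℕ} {x : ℝ} (hx : k ≤ x) :
    2 * y (k + 1) x ≤ y k x := by
  obtain ⟨n, hn⟩ := exists_nat_ge (x - k)
  replace hn : x ≤ k + n := sub_le_iff_le_add'.mp hn
  have hy_pos := pos_of_isFixedPt_picardStep hy (steepSeed_pos fun k ↦ two_pos.trans_le (hb k))
  induction n generalizing k x with
  | zero => exact two_mul_succ_le_of_isFixedPt_steepSeed_of_le hy hb hx (hn.trans (by simp))
  | succ n ih =>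
    obtain h_le | h_ge := le_total x (k + 1)
    · exact two_mul_succ_le_of_isFixedPt_steepSeed_of_le hy hb hx h_le
    have h_start : 2 * y (k + 1) (k + 1) ≤ y k (k + 1) :=
      two_mul_succ_le_of_isFixedPt_steepSeed_of_le hy hb (by simp) le_rfl
    have h_rate : ∀ t ∈ Set.Icc ((k : ℝ) + 1) x, y (k + 2) t ≤ y (k + 1) t := fun t ht ↦ by
      have := ih (k := k + 1) (x := t) (by simpa using ht.1)
        (by push_cast at hn ⊢; linarith [ht.2])
      linarith [hy_pos (k + 2) t]
    have h_int : ∫ t in (k : ℝ) + 1..x, y (k + 2) t ≤ ∫ t in (k : ℝ) + 1..x, y (k + 1) t :=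
      intervalIntegral.integral_mono_on h_ge ((hy_cont _).intervalIntegrable _ _)
        ((hy_cont _).intervalIntegrable _ _) h_rate
    calc 2 * y (k + 1) x
        = 2 * y (k + 1) (k + 1) * Real.exp (∫ t in (k : ℝ) + 1..x, y (k + 2) t) := by
          rw [eq_mul_exp_integral_of_isFixedPt_picardStep_of_le hy hy_cont (k := k + 1) (by simp)
            h_ge, mul_assoc]
      _ ≤ y k (k + 1) * Real.exp (∫ t in (k : ℝ) + 1..x, y (k + 1) t) := by
          gcongr
          exact (hy_pos k _).le
      _ = y k x :=
          (eq_mul_exp_integral_of_isFixedPt_picardStep_of_le hy hy_cont (by simp) h_ge).symm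

theorem le_of_isFixedPt_steepSeed (hb : ∀ k, 2 ≤ b k) {k m : ℕ} (hkm : k ≤ m) {x : ℝ} (hx : m ≤ x) :
    b m ≤ y k x := by
  have hy_pos := pos_of_isFixedPt_picardStep hy (steepSeed_pos fun k ↦ two_pos.trans_le (hb k))
  have h_anti : y m x ≤ y k x := by
    induction m, hkm using Nat.le_induction with
    | base => rfl
    | succ m _ ih =>
      have hmx : (m : ℝ) ≤ x := (Nat.cast_le.mpr m.le_succ).trans hx
      have h_two_mul : 2 * y (m + 1) x ≤ y m x :=
        two_mul_succ_le_of_isFixedPt_steepSeed hy hy_cont hb hmx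
      linarith [ih hmx, hy_pos (m + 1) x]
  have h_exp : 1 ≤ Real.exp (∫ t in (m : ℝ)..x, y (m + 1) t) :=
    Real.one_le_exp (intervalIntegral.integral_nonneg hx fun t _ ↦ (hy_pos (m + 1) t).le)
  calc b m ≤ b m * Real.exp (∫ t in (m : ℝ)..x, y (m + 1) t) :=
        le_mul_of_one_le_right (two_pos.trans_le (hb m)).le h_exp
    _ = y m x := by rw [eq_mul_exp_integral_of_isFixedPt_picardStep hy hx, steepSeed_self]
    _ ≤ y k x := h_anti

end FixedPoint

theorem exists_isLogDerivChain_ge (b : ℕ → ℝ) :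
    ∃ y : ℕ → ℝ → ℝ, IsLogDerivChain y ∧ ∀ k, ∀ᶠ x in atTop, b ⌊x⌋₊ ≤ y k x := by
  let c (m : ℕ) : ℝ := max 2 (b m)
  have hc (m : ℕ) : 2 ≤ c m := le_max_left _ _
  obtain ⟨y, hy_cont, hy⟩ := exists_isFixedPt_picardStep
    (continuous_steepSeed fun k ↦ two_pos.trans_le (hc k))
  refine ⟨y, ⟨fun k ↦ ?_, fun k ↦ ?_, fun k ↦ ?_⟩, fun k ↦ ?_⟩
  · filter_upwards [eventually_ge_atTop (k : ℝ)] with x hx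
    exact (hc k).trans (le_of_isFixedPt_steepSeed hy hy_cont hc le_rfl hx)
  · filter_upwards [eventually_gt_atTop (k : ℝ)] with x hx
    exact hasDerivAt_of_isFixedPt_picardStep hy hy_cont hx
  · filter_upwards [eventually_ge_atTop (k : ℝ)] with x hx
    exact two_mul_succ_le_of_isFixedPt_steepSeed hy hy_cont hc hx
  · filter_upwards [eventually_ge_atTop (k : ℝ)] with x hx
    exact (le_max_right _ _).trans (le_of_isFixedPt_steepSeed hy hy_cont hc (Nat.le_floor hx)
      (Nat.floor_le (k.cast_nonneg.trans hx)))

end SteepSeed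

end Construction

section Domination

theorem exists_le_comp_floor {φ : ℝ → ℝ} (hφ : ∀ᶠ t in atTop, ContinuousAt φ t) :
    ∃ c : ℕ → ℝ, ∀ᶠ t in atTop, φ t ≤ c ⌊t⌋₊ := by
  obtain ⟨a, ha⟩ := eventually_atTop.mp hφ
  have h_bound (m : ℕ) (hm : a ≤ m) : ∃ C, ∀ t ∈ Set.Icc (m : ℝ) (m + 1), φ t ≤ C := by
    obtain ⟨C, hC⟩ := isCompact_Icc.bddAbove_image (f := φ) fun t ht ↦
      (ha t (hm.trans ht.1)).continuousWithinAt
    exact ⟨C, fun t ht ↦ hC ⟨t, ht, rfl⟩⟩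
  choose! c hc using h_bound
  have h_floor : ∀ᶠ t : ℝ in atTop, a ≤ ⌊t⌋₊ :=
    (tendsto_natCast_atTop_atTop.comp tendsto_nat_floor_atTop).eventually_ge_atTop a
  refine ⟨c, ?_⟩
  filter_upwards [h_floor, eventually_ge_atTop 0] with t ht ht_nonneg
  exact hc _ ht t ⟨Nat.floor_le ht_nonneg, (Nat.lt_floor_add_one t).le⟩

theorem exists_forall_eventually_le {α : Type*} [SemilatticeSup α] (c : ℕ → ℕ → α) :
    ∃ b : ℕ → α, ∀ n, ∀ᶠ m in atTop, c n m ≤ b m := by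
  refine ⟨fun m ↦ (Finset.range (m + 1)).sup' Finset.nonempty_range_add_one fun i ↦ c i m,
    fun n ↦ ?_⟩
  filter_upwards [eventually_ge_atTop n] with m hm
  exact Finset.le_sup' (fun i ↦ c i m) (Finset.mem_range_succ_iff.mpr hm)

theorem exists_isLogDerivChain_forall_le {g : ℕ → GermsAtInfinity}
    (hg : ∀ n, ∃ g', GermHasDeriv (g n) g') :
    ∃ y : ℕ → ℝ → ℝ, IsLogDerivChain y ∧ ∀ n k, g n ≤ (y k : GermsAtInfinity) := by
  choose _ φ _ hφ _ h_deriv using hg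
  choose c hc using fun n ↦ exists_le_comp_floor ((h_deriv n).mono fun t ht ↦ ht.continuousAt)
  obtain ⟨b, hb⟩ := exists_forall_eventually_le c
  obtain ⟨y, hy, hby⟩ := exists_isLogDerivChain_ge b
  refine ⟨y, hy, fun n k ↦ hφ n ▸ Germ.coe_le.mpr ?_⟩
  filter_upwards [hc n, tendsto_nat_floor_atTop.eventually (hb n), hby k] with t h₁ h₂ h₃
  exact h₁.trans (h₂.trans h₃)

theorem IsHardyField.exists_extension_forall_le {H : Subring GermsAtInfinity}
    (hH : IsHardyField H) {g : ℕ → H} (hg : IsCofinal (Set.range g)) :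
    ∃ K, IsHardyField K ∧ H ≤ K ∧ ∃ y ∈ K, ∀ f ∈ H, f ≤ y := by
  obtain ⟨y, hy, hgy⟩ := exists_isLogDerivChain_forall_le (g := fun n ↦ (g n : GermsAtInfinity))
    fun n ↦ (hH.exists_deriv _ (g n).2).imp fun _ h ↦ h.2
  have hHy : ∀ k, ∀ f ∈ H, f ≤ (y k : GermsAtInfinity) := fun k f hf ↦ by
    obtain ⟨_, ⟨n, rfl⟩, hn⟩ := hg ⟨f, hf⟩
    exact le_trans hn (hgy n k)
  obtain ⟨K, hK, hHK, hyK⟩ := hy.exists_isHardyField_extension hH hHy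
  exact ⟨K, hK, hHK, y 0, hyK 0, hHy 0⟩

theorem aleph0_lt_cof_of_maximal_isHardyField {H : Subring GermsAtInfinity}
    (hH : Maximal IsHardyField H) : ℵ₀ < Order.cof H := by
  by_contra! h_cof
  obtain ⟨s, hs, hs_card⟩ := Order.exists_cof_eq (α := H)
  have hs_countable : s.Countable := by
    rwa [← Cardinal.le_aleph0_iff_set_countable, hs_card]
  obtain ⟨g, rfl⟩ := hs_countable.exists_eq_range hs.nonempty
  obtain ⟨K, hK, hHK, y, hyK, hHy⟩ := hH.prop.exists_extension_forall_le hs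
  have hyH : y ∈ H := hH.le_of_ge hK hHK hyK
  exact (lt_add_one y).not_ge (hHy _ (H.add_mem hyH H.one_mem))

end Domination

section OrderedField

theorem coinitiality_eq_cof (G : Type*) [AddCommGroup G] [PartialOrder G] [IsOrderedAddMonoid G] :
    coinitiality G = Order.cof G :=
  (OrderIso.neg G).cof_congr.symm

theorem cof_Ioi_eq_cof {α : Type*} [LinearOrder α] [NoMaxOrder α] (a : α) :
    Order.cof (Set.Ioi a) = Order.cof α :=
  Order.cof_eq_of_isCofinal fun x ↦
    have ⟨y, hy⟩ := exists_gt (max x a)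
    ⟨y, (le_max_right x a).trans_lt hy, (le_max_left x a).trans hy.le⟩

variable {K : Type*} [Field K] [LinearOrder K] [IsStrictOrderedRing K] (a : K)

theorem cof_Iio_eq_cof : Order.cof (Set.Iio a) = Order.cof K := by
  let f (x : Set.Ioi (0 : K)) : Set.Iio a := ⟨a - (x : K)⁻¹, sub_lt_self a (inv_pos.mpr x.2)⟩
  have hf_mono : StrictMono f := fun x y hxy ↦ sub_lt_sub_left (inv_strictAnti₀ x.2 hxy) a
  have hf_surj : Function.Surjective f := fun y ↦
    ⟨⟨(a - y)⁻¹, inv_pos.mpr (sub_pos.mpr y.2)⟩, Subtype.ext (by simp [f])⟩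
  rw [← cof_Ioi_eq_cof (0 : K)]
  exact (Order.cof_congr_of_strictMono hf_mono (hf_surj.range_eq ▸ IsCofinal.univ)).symm

theorem coinitiality_Ioi_eq_cof : coinitiality (Set.Ioi a) = Order.cof K := by
  let f (x : Set.Ioi (0 : K)) : (Set.Ioi a)ᵒᵈ :=
    OrderDual.toDual ⟨a + (x : K)⁻¹, lt_add_of_pos_right a (inv_pos.mpr x.2)⟩
  have hf_mono : StrictMono f := fun x y hxy ↦ add_lt_add_right (inv_strictAnti₀ x.2 hxy) a
  have hf_surj : Function.Surjective f := OrderDual.forall.mpr fun y ↦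
    ⟨⟨(y - a)⁻¹, inv_pos.mpr (sub_pos.mpr y.2)⟩, congrArg OrderDual.toDual
      (Subtype.ext (by simp))⟩
  rw [← cof_Ioi_eq_cof (0 : K)]
  exact (Order.cof_congr_of_strictMono hf_mono (hf_surj.range_eq ▸ IsCofinal.univ)).symm

end OrderedField

theorem mainTheorem11 (H : Subring GermsAtInfinity) (hH : Maximal IsHardyField H) :
    ℵ₀ < Order.cof H ∧
      ∀ a : H, coinitiality H = Order.cof (Set.Iio a) ∧
        Order.cof (Set.Iio a) = coinitiality (Set.Ioi a) ∧
        ℵ₀ < coinitiality (Set.Ioi a) := by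
  let _ : Field H := hH.prop.isField.toField
  let _ : LinearOrder H := hH.prop.linearOrder
  have : IsOrderedRing H := inferInstanceAs (IsOrderedRing H)
  have : IsStrictOrderedRing H := IsOrderedRing.toIsStrictOrderedRing H
  have h_cof : ℵ₀ < Order.cof H := aleph0_lt_cof_of_maximal_isHardyField hH
  refine ⟨h_cof, fun a ↦ ?_⟩
  rw [coinitiality_eq_cof H, cof_Iio_eq_cof a, coinitiality_Ioi_eq_cof a]
  exact ⟨rfl, rfl, h_cof⟩
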